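/- For $\alpha\in\mathbb{C}$ let $\mathbb{Z}[\alpha]$ denote the subring of $\mathbb{C}$ generated by $\alpha$, and for a set $F\subset\mathbb{Z}$ let $$F[\alpha]=\Big\{\sum_{i=0}^{\ell-1} f_i\alpha^i \;:\; \ell\ge 1,\ f_0,\dots,f_{\ell-1}\in F\Big\}.$$ **Theorem.** Let $\alpha\in\mathbb{C}$. There is a finite set $F\subset\mathbb{Z}$ such that $\mathbb{Z}[\alpha]=F[\alpha]$ if and only if $\alpha$ is an algebraic number whose conjugates over $\mathbb{Q}$ (the complex roots of its minimal polynomial over $\mathbb{Q}$, including $\alpha$ itself) are either all of modulus equal to $1$ or all of modulus greater than $1$. -/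

import Mathlib

/-- The set `F[α]` of all complex numbers `f₀ + f₁ α + ⋯ + f_{ℓ-1} α^{ℓ-1}` with `ℓ ≥ 1` and
all coefficients `f_i` in the set of integers `F`. -/
def digitExpansions (F : Set ℤ) (α : ℂ) : Set ℂ :=
  {z | ∃ ℓ : ℕ, 1 ≤ ℓ ∧ ∃ f : ℕ → ℤ, (∀ i < ℓ, f i ∈ F) ∧
    z = ∑ i ∈ Finset.range ℓ, (f i : ℂ) * α ^ i}

/-! Necessity: an expansion of an integer `n` is a rational relation, so it holds at every conjugate
`β` of `α`; if `‖β‖ < 1`, a geometric series would bound all `n`. So all conjugates have modulus at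
least 1. If one lies on the unit circle, the minimal polynomial is self-reciprocal up to a scalar,
the conjugates are closed under inversion, and all have modulus 1.

Sufficiency: let the integer polynomial `P` vanish at `α` and have no root in the open disc.
Averaging powers of `X / β` root by root gives `g` with tiny coefficients and `g ≡ 1` mod `P` over
`ℂ`. Then `R = g * R + h * P` with `g * R` small. Rounding the real part of `h` to an integer
polynomial `k` leaves `R - P * k` with coefficients bounded independently of `R`; these are the
digits. -/

/-- The coefficients of a product are bounded by a bound for the coefficients of one factor times
the sum of the norms of the coefficients of the other factor. -/
theorem Polynomial.norm_coeff_mul_le {R : Type*} [NormedRing R] (a b : Polynomial R) {M : ℝ}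
    (ha : ∀ i, ‖a.coeff i‖ ≤ M) (n : ℕ) :
    ‖(a * b).coeff n‖ ≤ M * ∑ i ∈ b.support, ‖b.coeff i‖ := by
  have hM : 0 ≤ M := (norm_nonneg _).trans (ha 0)
  conv_lhs => rw [b.as_sum_support_C_mul_X_pow, Finset.mul_sum, Polynomial.finsetSum_coeff]
  rw [Finset.mul_sum]
  refine (norm_sum_le _ _).trans (Finset.sum_le_sum fun i _ => ?_)
  rw [← mul_assoc, Polynomial.coeff_mul_X_pow']
  split_ifs
  · rw [Polynomial.coeff_mul_C]
    exact (norm_mul_le _ _).trans (mul_le_mul_of_nonneg_right (ha _) (norm_nonneg _))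
  · rw [norm_zero]
    positivity

/-- If `1 ≤ ‖β‖`, the averages of the polynomials `(X / β) ^ n` take the value `1` at `β` and have
arbitrarily small coefficients. -/
theorem exists_small_coeff_dvd_one_sub {β : ℂ} (hβ : 1 ≤ ‖β‖) {ε : ℝ} (hε : 0 < ε) :
    ∃ e : Polynomial ℂ, (Polynomial.X - Polynomial.C β) ∣ 1 - e ∧ ∀ i, ‖e.coeff i‖ ≤ ε := by
  obtain ⟨N, hN⟩ := exists_nat_one_div_lt hε
  have hβ0 : β ≠ 0 := norm_pos_iff.1 (one_pos.trans_le hβ)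
  have hN0 : ((N : ℂ) + 1) ≠ 0 := Nat.cast_add_one_ne_zero N
  refine ⟨∑ n ∈ Finset.range (N + 1), Polynomial.monomial n (((N : ℂ) + 1)⁻¹ * (β⁻¹) ^ n), ?_, ?_⟩
  · rw [Polynomial.dvd_iff_isRoot, Polynomial.IsRoot.def, Polynomial.eval_sub,
      Polynomial.eval_finsetSum]
    have h : ∀ n, ((N : ℂ) + 1)⁻¹ * (β⁻¹) ^ n * β ^ n = ((N : ℂ) + 1)⁻¹ := fun n => by
      rw [mul_assoc, ← mul_pow, inv_mul_cancel₀ hβ0, one_pow, mul_one]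
    simp only [Polynomial.eval_monomial, h]
    simp [hN0]
  · intro i
    rw [Polynomial.finsetSum_coeff]
    simp only [Polynomial.coeff_monomial, Finset.sum_ite_eq']
    split_ifs
    · rw [norm_mul, norm_pow, norm_inv, norm_inv]
      have h1 : ‖(N : ℂ) + 1‖ = (N : ℝ) + 1 := by exact_mod_cast Complex.norm_natCast (N + 1)
      have h2 : (‖β‖⁻¹) ^ i ≤ 1 := pow_le_one₀ (by positivity) (inv_le_one_of_one_le₀ hβ)
      rw [h1]
      calc ((N : ℝ) + 1)⁻¹ * (‖β‖⁻¹) ^ i ≤ ((N : ℝ) + 1)⁻¹ * 1 := by gcongr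
        _ ≤ ε := by rw [mul_one, ← one_div]; exact hN.le
    · simpa using hε.le

/-- Modulo a product of linear factors with roots outside the open unit disc, the constant `1` is
congruent to polynomials with arbitrarily small coefficients. -/
theorem exists_small_coeff_prod_dvd_one_sub (s : Multiset ℂ) (hs : ∀ β ∈ s, 1 ≤ ‖β‖) :
    ∀ ε : ℝ, 0 < ε → ∃ g : Polynomial ℂ,
      (s.map fun β => Polynomial.X - Polynomial.C β).prod ∣ 1 - g ∧ ∀ i, ‖g.coeff i‖ ≤ ε := by
  induction s using Multiset.induction_on with
  | empty => exact fun ε hε => ⟨0, by simp, by simp [hε.le]⟩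
  | cons β s ih =>
    intro ε hε
    obtain ⟨g, hg, hgε⟩ := ih (fun γ hγ => hs γ (Multiset.mem_cons_of_mem hγ)) (ε / 2) (half_pos hε)
    set L : ℝ := ∑ i ∈ (1 - g).support, ‖(1 - g).coeff i‖
    have hL : 0 ≤ L := Finset.sum_nonneg fun _ _ => norm_nonneg _
    -- The tolerance for `e` offsets the coefficient sum `L` of `1 - g`; the `+ 1` avoids dividing
    -- by zero.
    obtain ⟨e, he, heε⟩ := exists_small_coeff_dvd_one_sub (hs β (Multiset.mem_cons_self β s))
      (show 0 < ε / 2 / (L + 1) by positivity)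
    -- Chosen so that `1 - g` gains the factor `1 - e`, hence one more linear factor; repeated roots
    -- need no special care.
    refine ⟨g + e * (1 - g), ?_, fun i => ?_⟩
    · rw [Multiset.map_cons, Multiset.prod_cons,
        show 1 - (g + e * (1 - g)) = (1 - e) * (1 - g) by ring]
      exact mul_dvd_mul he hg
    · rw [Polynomial.coeff_add]
      have h1 := Polynomial.norm_coeff_mul_le e (1 - g) heε i
      have h2 : ε / 2 / (L + 1) * L ≤ ε / 2 := by
        rw [div_mul_eq_mul_div, div_le_iff₀ (by positivity)]
        nlinarith
      linarith [norm_add_le (g.coeff i) ((e * (1 - g)).coeff i), hgε i]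

/-- Modulo an integer polynomial `P ≠ 0` without roots in the open unit disc, every integer
polynomial is congruent to one with coefficients bounded in terms of `P` only. -/
theorem exists_bounded_coeff_dvd_sub {P : Polynomial ℤ} (hP : P ≠ 0)
    (hroots : ∀ β ∈ P.aroots ℂ, 1 ≤ ‖β‖) (R : Polynomial ℤ) :
    ∃ r : Polynomial ℤ, P ∣ R - r ∧
      ∀ n, |(r.coeff n : ℝ)| ≤ 1 + ∑ i ∈ (P.map (Int.castRingHom ℝ)).support,
        ‖(P.map (Int.castRingHom ℝ)).coeff i‖ := by
  set PC := P.map (algebraMap ℤ ℂ) with hPC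
  set RC := R.map (algebraMap ℤ ℂ) with hRC
  set L : ℝ := ∑ i ∈ RC.support, ‖RC.coeff i‖
  have hL : 0 ≤ L := Finset.sum_nonneg fun _ _ => norm_nonneg _
  obtain ⟨g, hg, hgε⟩ := exists_small_coeff_prod_dvd_one_sub _ hroots (1 / (L + 1)) (by positivity)
  have hPC0 : PC ≠ 0 := (Polynomial.map_ne_zero_iff (algebraMap ℤ ℂ).injective_int).2 hP
  have hdvd : PC ∣ 1 - g := by
    rw [(IsAlgClosed.splits PC).eq_prod_roots]
    refine (IsUnit.mul_left_dvd ?_).2 hg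
    exact Polynomial.isUnit_C.2 (isUnit_iff_ne_zero.2 (Polynomial.leadingCoeff_ne_zero.2 hPC0))
  obtain ⟨h, hh⟩ : PC ∣ (1 - g) * RC := hdvd.mul_right RC
  set k : Polynomial ℤ := ∑ i ∈ h.support, Polynomial.monomial i (round (h.coeff i).re) with hk
  have hkc : ∀ i, k.coeff i = round (h.coeff i).re := fun i => by
    rw [hk, Polynomial.finsetSum_coeff]
    simp only [Polynomial.coeff_monomial, Finset.sum_ite_eq']
    split_ifs with hi
    · rfl
    · simp [Polynomial.notMem_support_iff.1 hi]
  set u : Polynomial ℝ := ∑ i ∈ h.support, Polynomial.monomial i (h.coeff i).re with hu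
  have huc : ∀ i, u.coeff i = (h.coeff i).re := fun i => by
    rw [hu, Polynomial.finsetSum_coeff]
    simp only [Polynomial.coeff_monomial, Finset.sum_ite_eq']
    split_ifs with hi
    · rfl
    · simp [Polynomial.notMem_support_iff.1 hi]
  set PR := P.map (Int.castRingHom ℝ) with hPR
  refine ⟨R - P * k, ⟨k, by ring⟩, fun n => ?_⟩
  -- `P` has real coefficients, so taking real parts coefficientwise commutes with multiplication by
  -- it.
  have hre : ((h * PC).coeff n).re = (u * PR).coeff n := by
    simp [Polynomial.coeff_mul, hPC, hPR, huc, Complex.re_sum]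
  -- Rounding errs by at most 1/2; the cruder bound 1 is enough.
  have hbound := Polynomial.norm_coeff_mul_le (u - k.map (Int.castRingHom ℝ)) PR (M := 1)
    (fun i => by
      rw [Polynomial.coeff_sub, huc, Polynomial.coeff_map, hkc, Real.norm_eq_abs]
      exact (abs_sub_round _).trans (by norm_num)) n
  have hgR : |((g * RC).coeff n).re| ≤ 1 := by
    refine (Complex.abs_re_le_norm _).trans ((Polynomial.norm_coeff_mul_le g RC hgε n).trans ?_)
    rw [div_mul_eq_mul_div, div_le_iff₀ (by positivity)]
    linarith
  have hR : ((R.coeff n : ℤ) : ℝ) = ((g * RC).coeff n).re + (u * PR).coeff n := by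
    rw [← hre, ← Complex.add_re, ← Polynomial.coeff_add, mul_comm h, ← hh,
      show g * RC + (1 - g) * RC = RC by ring]
    simp [hRC]
  have heq : (((R - P * k).coeff n : ℤ) : ℝ)
      = ((g * RC).coeff n).re + ((u - k.map (Int.castRingHom ℝ)) * PR).coeff n := by
    rw [sub_mul, Polynomial.coeff_sub, Polynomial.coeff_sub, Int.cast_sub, hR, hPR,
      ← Polynomial.map_mul, Polynomial.coeff_map, mul_comm k P]
    simp only [eq_intCast]
    ring
  rw [heq]
  rw [Real.norm_eq_abs, one_mul] at hbound
  exact (abs_add_le _ _).trans (add_le_add hgR hbound)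

/-- Integer digit expansions in base `α` lie in `ℤ[α]`. -/
theorem sum_range_mem_adjoin (f : ℕ → ℤ) (ℓ : ℕ) (α : ℂ) :
    ∑ i ∈ Finset.range ℓ, (f i : ℂ) * α ^ i ∈ Algebra.adjoin ℤ {α} :=
  Subalgebra.sum_mem _ fun i _ => Subalgebra.mul_mem _ (Subalgebra.intCast_mem _ _)
    (Subalgebra.pow_mem _ (Algebra.self_mem_adjoin_singleton ℤ α) i)

/-- If `α` is a root of an integer polynomial without roots in the open unit disc, then finitely
many integer digits suffice to represent `ℤ[α]`. -/
theorem exists_finite_adjoin_eq_digitExpansions {α : ℂ} {P : Polynomial ℤ} (hP : P ≠ 0)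
    (hα : Polynomial.aeval α P = 0) (hroots : ∀ β ∈ P.aroots ℂ, 1 ≤ ‖β‖) :
    ∃ F : Set ℤ, F.Finite ∧ (Algebra.adjoin ℤ {α} : Set ℂ) = digitExpansions F α := by
  set B : ℝ := 1 + ∑ i ∈ (P.map (Int.castRingHom ℝ)).support,
        ‖(P.map (Int.castRingHom ℝ)).coeff i‖ with hB
  refine ⟨Set.Icc (-⌊B⌋) ⌊B⌋, Set.finite_Icc _ _, Set.Subset.antisymm ?_ ?_⟩
  · intro z hz
    rw [SetLike.mem_coe, Algebra.adjoin_singleton_eq_range_aeval] at hz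
    obtain ⟨R, rfl⟩ := hz
    obtain ⟨r, ⟨q, hq⟩, hr⟩ := exists_bounded_coeff_dvd_sub hP hroots R
    refine ⟨r.natDegree + 1, Nat.le_add_left _ _, r.coeff, fun i _ => ?_, ?_⟩
    · rw [Set.mem_Icc, ← abs_le, Int.le_floor, Int.cast_abs]
      exact hr i
    · have h : Polynomial.aeval α (R - r) = 0 := by rw [hq, map_mul, hα, zero_mul]
      rw [map_sub, sub_eq_zero] at h
      change Polynomial.aeval α R = _
      rw [h, Polynomial.aeval_eq_sum_range]
      simp [zsmul_eq_mul]
  · rintro z ⟨ℓ, -, f, -, rfl⟩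
    exact sum_range_mem_adjoin f ℓ α

/-- If finitely many integer digits represent `ℤ[α]`, then `α` is algebraic. -/
theorem isAlgebraic_of_adjoin_eq_digitExpansions {α : ℂ} {F : Set ℤ} (hF : F.Finite)
    (h : (Algebra.adjoin ℤ {α} : Set ℂ) = digitExpansions F α) : IsAlgebraic ℤ α := by
  obtain ⟨M, hM⟩ := hF.bddAbove
  -- `M + 1` exceeds every digit, so the resulting relation has a nonzero constant term.
  have hmem : ((M + 1 : ℤ) : ℂ) ∈ digitExpansions F α := h ▸ Subalgebra.intCast_mem _ _
  obtain ⟨ℓ, hℓ, f, hf, hsum⟩ := hmem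
  refine ⟨∑ i ∈ Finset.range ℓ, Polynomial.monomial i (f i) - Polynomial.C (M + 1), fun h0 => ?_, ?_⟩
  · have hc := congrArg (fun p => Polynomial.coeff p 0) h0
    simp only [Polynomial.coeff_sub, Polynomial.finsetSum_coeff, Polynomial.coeff_monomial,
      Finset.sum_ite_eq', Finset.mem_range, Polynomial.coeff_C_zero, Polynomial.coeff_zero] at hc
    rw [if_pos (by omega)] at hc
    have := hM (hf 0 (by omega))
    omega
  · simp only [map_sub, map_sum, Polynomial.aeval_monomial, Polynomial.aeval_C]
    simp only [algebraMap_int_eq, eq_intCast]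
    rw [← hsum, sub_self]

/-- If finitely many integer digits represent `ℤ[α]`, then no conjugate of `α` lies in the open
unit disc. -/
theorem one_le_norm_of_adjoin_eq_digitExpansions {α β : ℂ} {F : Set ℤ} (hF : F.Finite)
    (h : (Algebra.adjoin ℤ {α} : Set ℂ) = digitExpansions F α) (hβ : IsConjRoot ℚ α β) :
    1 ≤ ‖β‖ := by
  by_contra! hlt
  obtain ⟨M, hM⟩ := (hF.image fun n : ℤ => ‖(n : ℂ)‖).bddAbove
  obtain ⟨n, hn⟩ := exists_nat_gt (M / (1 - ‖β‖))
  have hmem : ((n : ℤ) : ℂ) ∈ digitExpansions F α := h ▸ Subalgebra.intCast_mem _ _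
  obtain ⟨ℓ, hℓ, f, hf, hsum⟩ := hmem
  have hfM : ∀ i < ℓ, ‖(f i : ℂ)‖ ≤ M := fun i hi => hM ⟨f i, hf i hi, rfl⟩
  have hM0 : 0 ≤ M := (norm_nonneg _).trans (hfM 0 hℓ)
  set p : Polynomial ℚ := ∑ i ∈ Finset.range ℓ, Polynomial.monomial i (f i : ℚ) -
    Polynomial.C (n : ℚ) with hp
  have hval : ∀ γ : ℂ, Polynomial.aeval γ p = ∑ i ∈ Finset.range ℓ, (f i : ℂ) * γ ^ i - n := by
    intro γ
    simp [hp, Polynomial.aeval_monomial]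
  have hα : Polynomial.aeval α p = 0 := by
    rw [hval, ← hsum]
    simp
  have hβ0 : Polynomial.aeval β p = 0 :=
    Polynomial.aeval_eq_zero_of_dvd_aeval_eq_zero (minpoly.dvd ℚ α hα) hβ.aeval_eq_zero
  rw [hval, sub_eq_zero] at hβ0
  have hle : (n : ℝ) ≤ M / (1 - ‖β‖) := by
    calc (n : ℝ) = ‖∑ i ∈ Finset.range ℓ, (f i : ℂ) * β ^ i‖ := by rw [hβ0, Complex.norm_natCast]
      _ ≤ ∑ i ∈ Finset.range ℓ, M * ‖β‖ ^ i := by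
        refine norm_sum_le_of_le _ fun i hi => ?_
        rw [norm_mul, norm_pow]
        exact mul_le_mul_of_nonneg_right (hfM i (Finset.mem_range.1 hi)) (by positivity)
      _ = M * ∑ i ∈ Finset.range ℓ, ‖β‖ ^ i := by rw [Finset.mul_sum]
      _ ≤ M * (1 - ‖β‖)⁻¹ := by
        refine mul_le_mul_of_nonneg_left ?_ hM0
        rw [← tsum_geometric_of_lt_one (norm_nonneg β) hlt]
        exact (summable_geometric_of_lt_one (norm_nonneg β) hlt).sum_le_tsum _
          fun i _ => by positivity
      _ = M / (1 - ‖β‖) := rfl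
  exact absurd hn hle.not_gt

/-- If an algebraic number has a conjugate on the unit circle, its conjugates are stable under
inversion. -/
theorem IsConjRoot.inv_of_norm_eq_one {α β γ : ℂ} (hα : IsAlgebraic ℚ α)
    (hβ : IsConjRoot ℚ α β) (hβ1 : ‖β‖ = 1) (hγ : IsConjRoot ℚ α γ) :
    IsConjRoot ℚ α γ⁻¹ := by
  -- On the unit circle `β⁻¹` is the complex conjugate of `β`.
  have hreal : Polynomial.aeval β⁻¹ (minpoly ℚ α) = 0 := by
    have h := congrArg (starRingEnd ℂ) hβ.aeval_eq_zero
    rw [map_zero] at h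
    rw [Complex.inv_def, Complex.normSq_eq_norm_sq, hβ1]
    simp only [one_pow, inv_one, Complex.ofReal_one, mul_one]
    rw [← h]
    simp [Polynomial.aeval_eq_sum_range, Algebra.smul_def]
  have hβ0 : β ≠ 0 := norm_pos_iff.1 (hβ1 ▸ one_pos)
  have hrev : Polynomial.aeval β (minpoly ℚ α).reverse = 0 := by
    let := invertibleOfNonzero (inv_ne_zero hβ0)
    have h := (Polynomial.eval₂_reverse_eq_zero_iff (algebraMap ℚ ℂ) β⁻¹ (minpoly ℚ α)).2 hreal
    rwa [invOf_eq_inv, inv_inv] at h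
  have hrevγ : Polynomial.aeval γ (minpoly ℚ α).reverse = 0 :=
    Polynomial.aeval_eq_zero_of_dvd_aeval_eq_zero
      (minpoly.dvd ℚ β hrev) (hβ.symm.trans hγ).aeval_eq_zero
  have hγ0 : γ ≠ 0 := by
    rintro rfl
    exact hβ0 (hγ.symm.trans hβ).eq_zero
  refine isConjRoot_of_aeval_eq_zero hα.isIntegral ?_
  let := invertibleOfNonzero (inv_ne_zero hγ0)
  refine (Polynomial.eval₂_reverse_eq_zero_iff (algebraMap ℚ ℂ) γ⁻¹ (minpoly ℚ α)).1 ?_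
  rwa [invOf_eq_inv, inv_inv]

theorem theorem5p2 (α : ℂ) :
    (∃ F : Set ℤ, F.Finite ∧ (Algebra.adjoin ℤ {α} : Set ℂ) = digitExpansions F α) ↔
      (IsAlgebraic ℚ α ∧
        ((∀ β : ℂ, IsConjRoot ℚ α β → ‖β‖ = 1) ∨ (∀ β : ℂ, IsConjRoot ℚ α β → 1 < ‖β‖))) := by
  constructor
  · rintro ⟨F, hF, h⟩
    have hα : IsAlgebraic ℚ α :=
      (isAlgebraic_of_adjoin_eq_digitExpansions hF h).extendScalars Int.cast_injective
    refine ⟨hα, ?_⟩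
    by_cases hex : ∃ β : ℂ, IsConjRoot ℚ α β ∧ ‖β‖ = 1
    · obtain ⟨β, hβ, hβ1⟩ := hex
      refine Or.inl fun γ hγ => ?_
      have h1 := one_le_norm_of_adjoin_eq_digitExpansions hF h hγ
      have h2 := one_le_norm_of_adjoin_eq_digitExpansions hF h
        (IsConjRoot.inv_of_norm_eq_one hα hβ hβ1 hγ)
      rw [norm_inv] at h2
      exact le_antisymm ((one_le_inv₀ (one_pos.trans_le h1)).1 h2) h1
    · refine Or.inr fun γ hγ => lt_of_le_of_ne
        (one_le_norm_of_adjoin_eq_digitExpansions hF h hγ) fun h1 => hex ⟨γ, hγ, h1.symm⟩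
  · rintro ⟨hα, hconj⟩
    have hle : ∀ β : ℂ, IsConjRoot ℚ α β → 1 ≤ ‖β‖ := fun β hβ =>
      hconj.elim (fun h => (h β hβ).ge) fun h => (h β hβ).le
    have hroot : ∀ β : ℂ, Polynomial.aeval β
        (IsLocalization.integerNormalization (nonZeroDivisors ℤ) (minpoly ℚ α)) = 0 →
        Polynomial.aeval β (minpoly ℚ α) = 0 := fun β hβ => by
      obtain ⟨b, hb0, hb⟩ :=
        IsLocalization.integerNormalization_spec (nonZeroDivisors ℤ) (minpoly ℚ α)
      rw [← Polynomial.aeval_map_algebraMap ℚ, hb, map_zsmul, smul_eq_zero] at hβ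
      exact hβ.resolve_left (nonZeroDivisors.ne_zero hb0)
    refine exists_finite_adjoin_eq_digitExpansions
      (P := IsLocalization.integerNormalization (nonZeroDivisors ℤ) (minpoly ℚ α)) ?_
      (IsLocalization.integerNormalization_aeval_eq_zero _ _ (minpoly.aeval ℚ α)) fun β hβ => ?_
    -- If `P` were zero, `hroot` would make 0 a conjugate of `α`.
    · intro h0
      have h1 := hle 0 (isConjRoot_of_aeval_eq_zero hα.isIntegral (hroot 0 (by rw [h0, map_zero])))
      rw [norm_zero] at h1
      exact absurd h1 one_pos.not_ge
    · exact hle β (isConjRoot_of_aeval_eq_zero hα.isIntegral (hroot β (Polynomial.mem_aroots.1 hβ).2))
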